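/- Let $F$ be Thompson's group, i.e. the group of all piecewise linear increasing homeomorphisms of $[0,1]$ with finitely many linear segments, all slopes of the form $2^n$ ($n\in\mathbb Z$), and endpoints of segments that are finite binary fractions; products are composed from left to right. Let $x_0,x_1\in F$ be the functions $$x_0(t)=\begin{cases}2t&0\le t\le\frac14\\ t+\frac14&\frac14\le t\le\frac12\\ \frac t2+\frac12&\frac12\le t\le1\end{cases}\qquad x_1(t)=\begin{cases}t&0\le t\le\frac12\\ 2t-\frac12&\frac12\le t\le\frac58\\ t+\frac18&\frac58\le t\le\frac34\\ \frac t2+\frac12&\frac34\le t\le1\end{cases}$$ and $x_{i+1}=x_0^{-i}x_1x_0^{i}$ for $i\ge1$. A normal form is a word $$x_{i_1}^{s_1}\cdots x_{i_m}^{s_m}x_{j_n}^{-t_n}\cdots x_{j_1}^{-t_1}$$ ($m,n\ge0$, all $s_k,t_k>0$) with $i_1\le\dots\le i_m\ne j_n\ge\dots\ge j_1$ (the condition $i_m\neq j_n$ is void if $m=0$ or $n=0$), and such that if $x_i$ and $x_i^{-1}$ both occur, then $x_{i+1}$ or $x_{i+1}^{-1}$ also occurs. Its length is the number of its letters, $\sum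 s_k+\sum t_k$. Every element of $F$ is represented by a normal form. Let $\overrightarrow F=\langle x_0x_1,\,x_1x_2,\,x_2x_3\rangle\le F$ be Jones' subgroup and let $G=\langle x_0x_2,\,x_1x_2\rangle\le F$. **Theorem.** Let $w\in F\setminus\overrightarrow F$. Then the subgroup $\langle\overrightarrow F,w\rangle$ contains $G$. If the normal form of $w$ has even length, then $\langle\overrightarrow F,w\rangle=G$. Otherwise, $\langle\overrightarrow F,w\rangle=F$. -/

import Mathlib

namespace Thompson

open unitInterval

/-- Finite binary fractions `a / 2 ^ n`. (For numbers in `[0, 1]` the integer `a` is automatically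
nonnegative.) -/
def IsDyadic (x : ℝ) : Prop := ∃ (a : ℤ) (n : ℕ), x = a / 2 ^ n

theorem IsDyadic.zero : IsDyadic 0 := ⟨0, 0, by simp⟩

theorem IsDyadic.add {x y : ℝ} (hx : IsDyadic x) (hy : IsDyadic y) : IsDyadic (x + y) := by
  obtain ⟨a, n, rfl⟩ := hx
  obtain ⟨b, m, rfl⟩ := hy
  refine ⟨a * 2 ^ m + b * 2 ^ n, n + m, ?_⟩
  push_cast
  rw [pow_add]
  field_simp

theorem IsDyadic.neg {x : ℝ} (hx : IsDyadic x) : IsDyadic (-x) := by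
  obtain ⟨a, n, rfl⟩ := hx
  exact ⟨-a, n, by push_cast; ring⟩

theorem IsDyadic.sub {x y : ℝ} (hx : IsDyadic x) (hy : IsDyadic y) : IsDyadic (x - y) := by
  rw [sub_eq_add_neg]
  exact hx.add hy.neg

theorem IsDyadic.zpow_mul {x : ℝ} (hx : IsDyadic x) (k : ℤ) : IsDyadic ((2 : ℝ) ^ k * x) := by
  obtain ⟨a, n, rfl⟩ := hx
  obtain ⟨m, rfl | rfl⟩ := k.eq_nat_or_neg
  · refine ⟨2 ^ m * a, n, ?_⟩
    push_cast
    rw [zpow_natCast]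
    ring
  · refine ⟨a, n + m, ?_⟩
    rw [zpow_neg, zpow_natCast, pow_add]
    field_simp

/-- `g` is linear with slope a power of two on the interval `[a, b]`. -/
def AffineOn (g : I → I) (a b : I) : Prop :=
  ∃ k : ℤ, ∀ x ∈ Set.Icc a b, (g x : ℝ) = g a + 2 ^ k * ((x : ℝ) - a)

/-- `g` is an element of Thompson's group: there is a finite set `B` of points of `[0, 1]` such that
`g` is linear, with slope a power of two, on every interval without points of `B` in its interior,
and such that the points of the graph of `g` over `B` (the endpoints of the linear
segments) have finite binary coordinates. The order automorphisms of `[0, 1]` are exactly its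
increasing homeomorphisms. -/
def IsThompson (g : I ≃o I) : Prop :=
  ∃ B : Finset I, (∀ b ∈ B, IsDyadic (b : ℝ) ∧ IsDyadic (g b : ℝ)) ∧
    ∀ a b : I, a < b → (∀ c ∈ B, ¬ (a < c ∧ c < b)) → AffineOn g a b

theorem IsThompson.one : IsThompson 1 :=
  ⟨∅, by simp, fun a b _ _ => ⟨0, fun x _ => by simp⟩⟩

theorem IsThompson.dyadic {g : I ≃o I} (hg : IsThompson g) {x : I} (hx : IsDyadic (x : ℝ)) :
    IsDyadic (g x : ℝ) := by
  classical
  obtain ⟨B, hB, hlin⟩ := hg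
  have h0 : ∀ b ∈ insert 0 B, IsDyadic (b : ℝ) ∧ IsDyadic (g b : ℝ) := by
    intro b hb
    rcases Finset.mem_insert.1 hb with rfl | hb
    · have : g 0 = 0 := g.map_bot
      rw [this]
      exact ⟨by simpa using IsDyadic.zero, by simpa using IsDyadic.zero⟩
    · exact hB b hb
  let S := (insert 0 B).filter (fun b => b ≤ x)
  have hS : S.Nonempty := ⟨0, by simp [S]⟩
  have hm := S.max'_mem hS
  set a := S.max' hS with ha
  have hm' := Finset.mem_filter.1 hm
  rcases hm'.2.eq_or_lt with h | h
  · rw [← h]; exact (h0 a hm'.1).2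
  · obtain ⟨k, hk⟩ := hlin a x h (fun c hc hac => by
      have : c ∈ S := Finset.mem_filter.2 ⟨Finset.mem_insert_of_mem hc, hac.2.le⟩
      exact absurd (S.le_max' c this) (not_le.2 hac.1))
    rw [hk x ⟨h.le, le_rfl⟩]
    exact (h0 a hm'.1).2.add ((hx.sub (h0 a hm'.1).1).zpow_mul k)

theorem IsThompson.inv {g : I ≃o I} (hg : IsThompson g) : IsThompson g⁻¹ := by
  classical
  obtain ⟨B, hB, hlin⟩ := hg
  change IsThompson g.symm
  refine ⟨B.image g, ?_, ?_⟩
  · intro b hb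
    obtain ⟨c, hc, rfl⟩ := Finset.mem_image.1 hb
    rw [g.symm_apply_apply]
    exact ⟨(hB c hc).2, (hB c hc).1⟩
  · intro a b hab hc
    obtain ⟨k, hk⟩ := hlin (g.symm a) (g.symm b) (g.symm.lt_iff_lt.2 hab) (fun c hcB h =>
      hc (g c) (Finset.mem_image_of_mem _ hcB)
        ⟨by simpa using g.lt_iff_lt.2 h.1, by simpa using g.lt_iff_lt.2 h.2⟩)
    refine ⟨-k, fun x hx => ?_⟩
    have := hk (g.symm x) ⟨g.symm.le_iff_le.2 hx.1, g.symm.le_iff_le.2 hx.2⟩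
    rw [g.apply_symm_apply, g.apply_symm_apply] at this
    have h2 : ((2 : ℝ) ^ k) ≠ 0 := zpow_ne_zero _ two_ne_zero
    rw [this, zpow_neg]
    field_simp
    ring

theorem IsThompson.comp {f g : I ≃o I} (hf : IsThompson f) (hg : IsThompson g) :
    IsThompson (f.trans g) := by
  classical
  have hg' := hg
  have hfi := hf.inv
  obtain ⟨B, hB, hlin⟩ := hf
  obtain ⟨C, hC, hlin'⟩ := hg
  refine ⟨B ∪ C.image f.symm, ?_, ?_⟩
  · intro b hb
    rcases Finset.mem_union.1 hb with hb | hb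
    · exact ⟨(hB b hb).1, hg'.dyadic (hB b hb).2⟩
    · obtain ⟨c, hc, rfl⟩ := Finset.mem_image.1 hb
      refine ⟨hfi.dyadic (hC c hc).1, ?_⟩
      simpa using (hC c hc).2
  · intro a b hab hc
    obtain ⟨k, hk⟩ := hlin a b hab (fun c hcB => hc c (Finset.mem_union_left _ hcB))
    obtain ⟨l, hl⟩ := hlin' (f a) (f b) (f.lt_iff_lt.2 hab) (fun c hcC h =>
      hc (f.symm c) (Finset.mem_union_right _ (Finset.mem_image_of_mem _ hcC))
        ⟨by simpa using f.symm.lt_iff_lt.2 h.1, by simpa using f.symm.lt_iff_lt.2 h.2⟩)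
    refine ⟨l + k, fun x hx => ?_⟩
    have h1 := hk x hx
    have h2 := hl (f x) ⟨f.le_iff_le.2 hx.1, f.le_iff_le.2 hx.2⟩
    rw [h1] at h2
    simp only [OrderIso.trans_apply]
    rw [h2, zpow_add₀ two_ne_zero]
    ring

/-- Thompson's group `F`. Elements are composed from left to right, hence the opposite group. -/
def F : Subgroup (I ≃o I)ᵐᵒᵖ where
  carrier := {g | IsThompson g.unop}
  one_mem' := IsThompson.one
  mul_mem' := fun hf hg => IsThompson.comp hf hg
  inv_mem' := fun hg => IsThompson.inv hg

/-- The product `f g` in `F` is "first `f`, then `g`". -/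
theorem F.mul_apply (f g : F) (t : I) :
    (f * g).1.unop t = g.1.unop (f.1.unop t) := rfl

/-- An element of `F` from a strictly increasing surjection of `[0, 1]` with the required
piecewise linear structure. -/
noncomputable def mkF (f : I → I) (hmono : StrictMono f) (hsurj : Function.Surjective f)
    (h : IsThompson (hmono.orderIsoOfSurjective f hsurj)) : F :=
  ⟨MulOpposite.op (hmono.orderIsoOfSurjective f hsurj), h⟩

/-- The function `x₀`. -/
noncomputable def fun0 (t : I) : I :=
  ⟨if (t : ℝ) ≤ 1 / 4 then 2 * t else if (t : ℝ) ≤ 1 / 2 then t + 1 / 4 else t / 2 + 1 / 2, by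
    have h := t.2.1
    have h' := t.2.2
    split_ifs <;> constructor <;> linarith⟩

/-- The function `x₁`. -/
noncomputable def fun1 (t : I) : I :=
  ⟨if (t : ℝ) ≤ 1 / 2 then (t : ℝ) else if (t : ℝ) ≤ 5 / 8 then 2 * t - 1 / 2
    else if (t : ℝ) ≤ 3 / 4 then t + 1 / 8 else t / 2 + 1 / 2, by
    have h := t.2.1
    have h' := t.2.2
    split_ifs <;> constructor <;> linarith⟩

theorem fun0_strictMono : StrictMono fun0 := by
  intro a b hab
  have hab' : (a : ℝ) < b := hab
  rw [← Subtype.coe_lt_coe]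
  simp only [fun0]
  split_ifs <;> linarith

theorem fun1_strictMono : StrictMono fun1 := by
  intro a b hab
  have hab' : (a : ℝ) < b := hab
  rw [← Subtype.coe_lt_coe]
  simp only [fun1]
  split_ifs <;> linarith

theorem fun0_surjective : Function.Surjective fun0 := by
  intro y
  have h := y.2.1
  have h' := y.2.2
  refine ⟨⟨if (y : ℝ) ≤ 1 / 2 then y / 2 else if (y : ℝ) ≤ 3 / 4 then y - 1 / 4 else 2 * y - 1, by
    split_ifs <;> constructor <;> linarith⟩, ?_⟩
  apply Subtype.ext
  simp only [fun0]
  split_ifs <;> linarith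

theorem fun1_surjective : Function.Surjective fun1 := by
  intro y
  have h := y.2.1
  have h' := y.2.2
  refine ⟨⟨if (y : ℝ) ≤ 1 / 2 then (y : ℝ) else if (y : ℝ) ≤ 3 / 4 then y / 2 + 1 / 4
    else if (y : ℝ) ≤ 7 / 8 then y - 1 / 8 else 2 * y - 1, by
    split_ifs <;> constructor <;> linarith⟩, ?_⟩
  apply Subtype.ext
  simp only [fun1]
  split_ifs <;> linarith

theorem fun0_isThompson :
    IsThompson (fun0_strictMono.orderIsoOfSurjective fun0 fun0_surjective) := by
  classical
  refine ⟨{⟨1 / 4, by norm_num, by norm_num⟩, ⟨1 / 2, by norm_num, by norm_num⟩}, ?_, ?_⟩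
  · simp only [Finset.mem_insert, Finset.mem_singleton, forall_eq_or_imp, forall_eq,
      StrictMono.coe_orderIsoOfSurjective, fun0]
    exact ⟨⟨⟨1, 2, by norm_num⟩, ⟨1, 1, by norm_num⟩⟩, ⟨1, 1, by norm_num⟩, ⟨3, 2, by norm_num⟩⟩
  · intro a b hab hc
    simp only [Finset.mem_insert, Finset.mem_singleton, forall_eq_or_imp, forall_eq,
      ← Subtype.coe_lt_coe, not_and, not_lt] at hc
    obtain ⟨h1, h2⟩ := hc
    have hab' : (a : ℝ) < b := hab
    simp only [AffineOn, StrictMono.coe_orderIsoOfSurjective, Set.mem_Icc, ← Subtype.coe_le_coe,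
      fun0]
    by_cases ha1 : (a : ℝ) < 1 / 4
    · have := h1 ha1
      exact ⟨1, fun x hx => by split_ifs <;> norm_num <;> linarith⟩
    · by_cases ha2 : (a : ℝ) < 1 / 2
      · have := h2 ha2
        exact ⟨0, fun x hx => by split_ifs <;> norm_num <;> linarith⟩
      · exact ⟨-1, fun x hx => by split_ifs <;> norm_num <;> linarith⟩

theorem fun1_isThompson :
    IsThompson (fun1_strictMono.orderIsoOfSurjective fun1 fun1_surjective) := by
  classical
  refine ⟨{⟨1 / 2, by norm_num, by norm_num⟩, ⟨5 / 8, by norm_num, by norm_num⟩,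
    ⟨3 / 4, by norm_num, by norm_num⟩}, ?_, ?_⟩
  · simp only [Finset.mem_insert, Finset.mem_singleton, forall_eq_or_imp, forall_eq,
      StrictMono.coe_orderIsoOfSurjective, fun1]
    exact ⟨⟨⟨1, 1, by norm_num⟩, ⟨1, 1, by norm_num⟩⟩, ⟨⟨5, 3, by norm_num⟩, ⟨3, 2, by norm_num⟩⟩,
      ⟨3, 2, by norm_num⟩, ⟨7, 3, by norm_num⟩⟩
  · intro a b hab hc
    simp only [Finset.mem_insert, Finset.mem_singleton, forall_eq_or_imp, forall_eq,
      ← Subtype.coe_lt_coe, not_and, not_lt] at hc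
    obtain ⟨h1, h2, h3⟩ := hc
    have hab' : (a : ℝ) < b := hab
    simp only [AffineOn, StrictMono.coe_orderIsoOfSurjective, Set.mem_Icc, ← Subtype.coe_le_coe,
      fun1]
    by_cases ha1 : (a : ℝ) < 1 / 2
    · have := h1 ha1
      exact ⟨0, fun x hx => by split_ifs <;> norm_num <;> linarith⟩
    · by_cases ha2 : (a : ℝ) < 5 / 8
      · have := h2 ha2
        exact ⟨1, fun x hx => by split_ifs <;> norm_num <;> linarith⟩
      · by_cases ha3 : (a : ℝ) < 3 / 4
        · have := h3 ha3
          exact ⟨0, fun x hx => by split_ifs <;> norm_num <;> linarith⟩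
        · exact ⟨-1, fun x hx => by split_ifs <;> norm_num <;> linarith⟩

/-- The generators `x₀, x₁, x₂, …` of `F`, with `x_{i+1} = x₀⁻ⁱ x₁ x₀ⁱ` for `i ≥ 0`. -/
noncomputable def x : ℕ → F
  | 0 => mkF fun0 fun0_strictMono fun0_surjective fun0_isThompson
  | i + 1 =>
    ((mkF fun0 fun0_strictMono fun0_surjective fun0_isThompson) ^ i)⁻¹ *
      mkF fun1 fun1_strictMono fun1_surjective fun1_isThompson *
      (mkF fun0 fun0_strictMono fun0_surjective fun0_isThompson) ^ i

/-- Jones' subgroup, given by its generators `x₀x₁, x₁x₂, x₂x₃`. -/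
noncomputable def jones : Subgroup F := Subgroup.closure {x 0 * x 1, x 1 * x 2, x 2 * x 3}

/-- The subgroup `G = ⟨x₀x₂, x₁x₂⟩`. -/
noncomputable def G : Subgroup F := Subgroup.closure {x 0 * x 2, x 1 * x 2}

/-- Words in the alphabet `{x₀, x₁, …}^{±1}`: the letter `(i, true)` is `xᵢ`, the letter
`(i, false)` is `xᵢ⁻¹`. The length of the list is the length of the word. -/
abbrev Word : Type := List (ℕ × Bool)

/-- The element of `F` represented by a word. -/
noncomputable def Word.eval (u : Word) : F :=
  (u.map fun l => if l.2 then x l.1 else (x l.1)⁻¹).prod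

/-- A word `x_{i₁} ⋯ x_{iₘ} x_{jₙ}⁻¹ ⋯ x_{j₁}⁻¹` (powers written out letter by letter) is a normal
form if `i₁ ≤ ⋯ ≤ iₘ ≠ jₙ ≥ ⋯ ≥ j₁` and if, whenever `xᵢ` and `xᵢ⁻¹` both occur, at least one of
`x_{i+1}`, `x_{i+1}⁻¹` occurs. Here `p` lists `i₁, …, iₘ` and `q` lists `j₁, …, jₙ`; either may be
empty, and then the condition `iₘ ≠ jₙ` is void. -/
def Word.IsNormalForm (u : Word) : Prop :=
  ∃ p q : List ℕ,
    u = p.map (fun i => (i, true)) ++ q.reverse.map (fun j => (j, false)) ∧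
    p.Pairwise (· ≤ ·) ∧ q.Pairwise (· ≤ ·) ∧
    (∀ i, p.getLast? = some i → q.getLast? ≠ some i) ∧
    ∀ i, i ∈ p → i ∈ q → i + 1 ∈ p ∨ i + 1 ∈ q

end Thompson

/-! Write H for the subgroup generated by Jones' subgroup and `w`. Jones' subgroup contains all `y i
= x i * x (i + 1)`.

The inclusion `G ≤ H` comes from good double coset representatives. Read a positive word as
instructions for adding carets to a binary forest with roots 0, 1, 2, …, and colour the leaves with
two colours: the roots alternate, a left child inherits its parent's colour, a right child takes the
other one. Wherever two neighbouring leaves have the same colour, a caret at the left one restores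
the alternation. Up to elements `y i`, a positive word is undone by the carets that restore the
alternation (`exists_x_mul_pos_clear`). So `w⁻¹` lies in the double coset of a positive word whose
indices have gaps at least 2 (`exists_double_coset`). If that word is empty, `w` is in Jones'
subgroup. Otherwise let `x k` be its last letter: the word conjugates some `y a` to `(x k)⁻¹ * y k *
x k = x (k + 1) * x k = x k * x (k + 2)`, which is therefore in H. Conjugation by `y 0` and a short
computation bring this down to `x 0 * x 2` (`x_zero_mul_x_two_mem`).

The dichotomy is a parity argument. Every `x i * x j` lies in `G` (by `x_mem_cosets_G`), so words of
even length evaluate into `G`, and for a word of odd length the product with `x 0` on the left does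
(`eval_mem_G`). In the odd case H contains `x 0`, hence all `x i`, which generate `F`.

Generation, relations and normal forms are derived from the action on standard dyadic intervals: `x
0` sends 00, 01, 1 to 0, 10, 11, and `x (n + 1)` is the identity on the left half and a copy of `x
n` on the right half. -/

namespace Thompson

open unitInterval

/-! ### Self-similar action of the generators, and the relations of `F` -/

/-- The action of an element of `F` on the unit interval. -/
def act (g : F) (t : I) : I := g.1.unop t

theorem act_mul (g h : F) (t : I) : act (g * h) t = act h (act g t) := rfl

theorem act_one (t : I) : act 1 t = t := rfl

theorem act_inv_act (g : F) (t : I) : act g⁻¹ (act g t) = t := by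
  rw [← act_mul, mul_inv_cancel, act_one]

theorem act_injective (g : F) : Function.Injective (act g) := g.1.unop.injective

theorem ext_act {g h : F} (H : ∀ t, act g t = act h t) : g = h := by
  apply Subtype.ext
  apply MulOpposite.unop_injective
  exact OrderIso.ext (funext H)

/-- The affine maps of `[0, 1]` onto its left half and onto its right half. -/
noncomputable def half (b : Bool) (t : I) : I :=
  ⟨(t + if b then 1 else 0) / 2, by
    have h := t.2.1
    have h' := t.2.2
    cases b <;> simp <;> constructor <;> linarith⟩

theorem coe_half_false (t : I) : (half false t : ℝ) = t / 2 := by simp [half]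

theorem coe_half_true (t : I) : (half true t : ℝ) = (t + 1) / 2 := by simp [half]

theorem exists_half (t : I) : ∃ b s, t = half b s := by
  have h := t.2.1
  have h' := t.2.2
  rcases le_total (t : ℝ) (1 / 2) with h2 | h2
  · exact ⟨false, ⟨2 * t, by constructor <;> linarith⟩,
      Subtype.ext (by rw [coe_half_false]; ring)⟩
  · exact ⟨true, ⟨2 * t - 1, by constructor <;> linarith⟩,
      Subtype.ext (by rw [coe_half_true]; ring)⟩

theorem half_injective (b : Bool) : Function.Injective (half b) := by
  intro s t h
  have := congrArg Subtype.val h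
  simp only [half] at this
  exact Subtype.ext (by linarith)

/-- An element of `F` is determined by its values on the two halves of `[0, 1]`. -/
theorem ext_half {g h : F} (h0 : ∀ t, act g (half false t) = act h (half false t))
    (h1 : ∀ t, act g (half true t) = act h (half true t)) : g = h := by
  refine ext_act fun t => ?_
  obtain ⟨b, s, rfl⟩ := exists_half t
  cases b
  · exact h0 s
  · exact h1 s

theorem act_x_zero (t : I) : act (x 0) t = fun0 t := rfl

theorem act_x_one (t : I) : act (x 1) t = fun1 t := by
  have : x 1 = mkF fun1 fun1_strictMono fun1_surjective fun1_isThompson := by simp [x]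
  rw [this]; rfl

theorem x_zero_ff (t : I) : act (x 0) (half false (half false t)) = half false t := by
  have h' := t.2.2
  apply Subtype.ext
  simp only [act_x_zero, fun0, coe_half_false]
  split_ifs <;> linarith

theorem x_zero_ft (t : I) :
    act (x 0) (half false (half true t)) = half true (half false t) := by
  have h := t.2.1
  have h' := t.2.2
  apply Subtype.ext
  simp only [act_x_zero, fun0, coe_half_false, coe_half_true]
  split_ifs <;> linarith

theorem x_zero_t (t : I) : act (x 0) (half true t) = half true (half true t) := by
  have h := t.2.1
  apply Subtype.ext
  simp only [act_x_zero, fun0, coe_half_true]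
  split_ifs <;> linarith

theorem x_mul_x_zero (n : ℕ) : x (n + 1) * x 0 = x 0 * x (n + 2) := by
  have h : ∀ n, x (n + 1) = (x 0 ^ n)⁻¹ * x 1 * x 0 ^ n := fun n => by simp [x]
  rw [h n, h (n + 1), pow_succ]
  group

theorem x_succ_false (n : ℕ) (t : I) :
    act (x (n + 1)) (half false t) = half false t := by
  induction n generalizing t with
  | zero =>
    have h' := t.2.2
    apply Subtype.ext
    simp only [zero_add, act_x_one, fun1, coe_half_false]
    split_ifs <;> linarith
  | succ n ih =>
    rw [← x_zero_ff, ← act_mul, ← x_mul_x_zero, act_mul, ih]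

/-- Self-similarity: since `x 0` maps 01 to 10 and 1 to 11, the relation `x_mul_x_zero` transports
the action of `x (n + 1)` on 01 and 1 to that of `x (n + 2)` on 10 and 11. -/
theorem x_succ_true (n : ℕ) (t : I) :
    act (x (n + 1)) (half true t) = half true (act (x n) t) := by
  induction n generalizing t with
  | zero =>
    have h := t.2.1
    have h' := t.2.2
    apply Subtype.ext
    simp only [zero_add, act_x_one, act_x_zero, fun0, fun1, coe_half_true]
    split_ifs <;> linarith
  | succ n ih =>
    obtain ⟨b, s, rfl⟩ := exists_half t
    cases b
    · rw [x_succ_false, ← x_zero_ft, ← act_mul, ← x_mul_x_zero, act_mul, x_succ_false]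
    · rw [← x_zero_t, ← act_mul, ← x_mul_x_zero, act_mul, ih, x_zero_t]

/-- The defining relations of `F`. -/
theorem x_mul_x {i j : ℕ} (h : j < i) : x i * x j = x j * x (i + 1) := by
  induction j generalizing i with
  | zero =>
    obtain ⟨n, rfl⟩ := Nat.exists_eq_succ_of_ne_zero h.ne'
    exact x_mul_x_zero n
  | succ j ih =>
    obtain ⟨n, rfl⟩ := Nat.exists_eq_succ_of_ne_zero (by omega : i ≠ 0)
    refine ext_half (fun t => ?_) (fun t => ?_)
    · simp only [act_mul, Nat.succ_eq_add_one, x_succ_false]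
    · simp only [act_mul, Nat.succ_eq_add_one, x_succ_true]
      rw [← act_mul, ih (by omega), act_mul]

/-! ### Standard dyadic intervals and their addresses -/

/-- The affine map from `[0, 1]` onto the standard dyadic interval with address `u`. -/
noncomputable def cone : List Bool → I → I
  | [], t => t
  | b :: u, t => half b (cone u t)

theorem cone_append (u v : List Bool) (t : I) : cone (u ++ v) t = cone u (cone v t) := by
  induction u with
  | nil => rfl
  | cons b u ih => simp [cone, ih]

theorem coe_cone (u : List Bool) (t : I) :
    (cone u t : ℝ) = cone u 0 + t / 2 ^ u.length := by
  induction u with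
  | nil => simp [cone]
  | cons b u ih =>
    simp only [cone, half, List.length_cons, pow_succ]
    rw [ih]
    field_simp
    ring

theorem cone_injective_right (u : List Bool) : Function.Injective (cone u) := by
  induction u with
  | nil => exact Function.injective_id
  | cons b u ih => exact (half_injective b).comp ih

theorem half_false_eq_half_true {s t : I} (h : half false s = half true t) : s = 1 ∧ t = 0 := by
  have h1 := congrArg Subtype.val h
  rw [coe_half_false, coe_half_true] at h1
  have := s.2.2
  have := t.2.1
  exact ⟨Subtype.ext (by rw [Set.Icc.coe_one]; linarith),
    Subtype.ext (by rw [Set.Icc.coe_zero]; linarith)⟩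

/-- The two halves meet only in the midpoint, while a standard dyadic interval has two distinct
endpoints. -/
theorem half_cone_ne (b : Bool) (u : List Bool) :
    ¬ ∀ t, ∃ s, half b (cone u t) = half (!b) s := by
  intro h
  obtain ⟨s, hs⟩ := h 0
  obtain ⟨s', hs'⟩ := h 1
  have key : cone u 0 = cone u 1 := by
    cases b
    · rw [(half_false_eq_half_true hs).1, (half_false_eq_half_true hs').1]
    · rw [(half_false_eq_half_true hs.symm).2, (half_false_eq_half_true hs'.symm).2]
  exact zero_ne_one (cone_injective_right u key)

theorem half_ne_id (b : Bool) (f : I → I) : ¬ ∀ t, half b (f t) = t := by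
  intro h
  cases b
  · have := congrArg Subtype.val (h 1)
    rw [coe_half_false] at this
    have := (f 1).2.2
    simp at *
    linarith
  · have := congrArg Subtype.val (h 0)
    rw [coe_half_true] at this
    have := (f 0).2.1
    simp at *
    linarith

theorem cone_injective {u v : List Bool} (h : ∀ t, cone u t = cone v t) : u = v := by
  induction u generalizing v with
  | nil =>
    cases v with
    | nil => rfl
    | cons c v => exact absurd (fun t => (h t).symm) (half_ne_id c (cone v))
  | cons b u ih =>
    cases v with
    | nil => exact absurd h (half_ne_id b (cone u))
    | cons c v =>
      by_cases hbc : c = b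
      · subst hbc
        rw [ih fun t => half_injective c (h t)]
      · obtain rfl : c = !b := by cases b <;> cases c <;> simp_all
        exact absurd (fun t => ⟨_, h t⟩) (half_cone_ne b u)

theorem exists_cone_zero_eq (u : List Bool) :
    ∃ a : ℕ, (cone u 0 : ℝ) = a / 2 ^ u.length := by
  induction u with
  | nil => exact ⟨0, by simp [cone]⟩
  | cons b u ih =>
    obtain ⟨a, ha⟩ := ih
    cases b
    · refine ⟨a, ?_⟩
      rw [cone, coe_half_false, ha, List.length_cons, pow_succ]
      field_simp
    · refine ⟨a + 2 ^ u.length, ?_⟩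
      rw [cone, coe_half_true, ha, List.length_cons, pow_succ]
      push_cast
      field_simp

theorem exists_cone_of_lt {a m : ℕ} (h : a < 2 ^ m) :
    ∃ u : List Bool, u.length = m ∧ (cone u 0 : ℝ) = a / 2 ^ m := by
  induction m generalizing a with
  | zero =>
    obtain rfl : a = 0 := by simpa using h
    exact ⟨[], rfl, by simp [cone]⟩
  | succ m ih =>
    by_cases h2 : a < 2 ^ m
    · obtain ⟨u, hu, hc⟩ := ih h2
      refine ⟨false :: u, by simp [hu], ?_⟩
      rw [cone, coe_half_false, hc, pow_succ]
      field_simp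
    · rw [pow_succ] at h
      obtain ⟨u, hu, hc⟩ := ih (a := a - 2 ^ m) (by omega)
      refine ⟨true :: u, by simp [hu], ?_⟩
      rw [cone, coe_half_true, hc, pow_succ, Nat.cast_sub (by omega)]
      push_cast
      field_simp
      ring

theorem cone_zero_eq_zero {u : List Bool} (h : cone u 0 = 0) :
    u = List.replicate u.length false := by
  induction u with
  | nil => rfl
  | cons b u ih =>
    have h1 := congrArg Subtype.val h
    cases b
    · rw [cone, coe_half_false] at h1
      have : cone u 0 = 0 := Subtype.ext (by rw [Set.Icc.coe_zero] at *; linarith)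
      rw [List.length_cons, List.replicate_succ, ← ih this]
    · rw [cone, coe_half_true] at h1
      have := (cone u 0).2.1
      simp at *
      linarith

/-! ### Elements of `F` as maps between standard dyadic intervals -/

/-- `g` maps the standard dyadic interval `u` affinely onto the standard dyadic interval `v`. -/
def MapsCone (g : F) (u v : List Bool) : Prop := ∀ t, act g (cone u t) = cone v t

theorem MapsCone.append {g : F} {u v : List Bool} (h : MapsCone g u v) (w : List Bool) :
    MapsCone g (u ++ w) (v ++ w) := fun t => by
  rw [cone_append, cone_append, h]

theorem MapsCone.mul {g h : F} {u v w : List Bool} (hg : MapsCone g u v) (hh : MapsCone h v w) :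
    MapsCone (g * h) u w := fun t => by
  rw [act_mul, hg, hh]

theorem MapsCone.inv {g : F} {u v : List Bool} (hg : MapsCone g u v) : MapsCone g⁻¹ v u :=
  fun t => by rw [← hg, act_inv_act]

theorem MapsCone.one (u : List Bool) : MapsCone 1 u u := fun _ => rfl

theorem MapsCone.left_unique {g : F} {u u' v : List Bool} (h : MapsCone g u v)
    (h' : MapsCone g u' v) : u = u' :=
  cone_injective fun t => act_injective g ((h t).trans (h' t).symm)

/-- An element of `F` maps every sufficiently small standard dyadic interval affinely onto a
standard dyadic interval. -/
theorem exists_forall_mapsCone (g : F) :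
    ∃ N, ∀ w : List Bool, w.length = N → ∃ v, MapsCone g w v := by
  have hg : IsThompson g.1.unop := g.2
  obtain ⟨B, hB, hlin⟩ := id hg
  -- With a common denominator `2 ^ M` of all break points, no interval of depth `M` has a break
  -- point in its interior.
  obtain ⟨M, hM⟩ : ∃ M : ℕ, ∀ b ∈ B, ∃ a : ℤ, (b : ℝ) = a / 2 ^ M := by
    clear hlin
    classical
    induction B using Finset.induction with
    | empty => exact ⟨0, by simp⟩
    | insert b B _ ih =>
      obtain ⟨M, hM⟩ := ih fun c hc => hB c (Finset.mem_insert_of_mem hc)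
      obtain ⟨a, n, hb⟩ := (hB b (Finset.mem_insert_self _ _)).1
      refine ⟨M + n, fun c hc => ?_⟩
      rcases Finset.mem_insert.1 hc with rfl | hc
      · refine ⟨a * 2 ^ M, ?_⟩
        rw [hb, pow_add]; push_cast; field_simp
      · obtain ⟨a', ha'⟩ := hM c hc
        refine ⟨a' * 2 ^ n, ?_⟩
        rw [ha', pow_add]; push_cast; field_simp
  have base : ∀ u : List Bool, u.length = M → ∃ N, ∀ w : List Bool, N ≤ w.length →
      ∃ v, MapsCone g (u ++ w) v := by
    intro u hu
    obtain ⟨a, ha⟩ := exists_cone_zero_eq u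
    rw [hu] at ha
    have hcu := coe_cone u
    rw [hu] at hcu
    have h2 : (0 : ℝ) < 2 ^ M := by positivity
    obtain ⟨k, hk⟩ := hlin (cone u 0) (cone u 1) (by
        rw [← Subtype.coe_lt_coe, hcu 1]; simp) (by
      rintro b hb ⟨h3, h4⟩
      obtain ⟨c, hc⟩ := hM b hb
      rw [← Subtype.coe_lt_coe, hc, ha, div_lt_div_iff_of_pos_right h2] at h3
      rw [← Subtype.coe_lt_coe, hcu 1, hc, ha, Set.Icc.coe_one, ← add_div,
        div_lt_div_iff_of_pos_right h2] at h4
      have h3' : (a : ℤ) < c := by exact_mod_cast h3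
      have h4' : c < (a : ℤ) + 1 := by exact_mod_cast h4
      omega)
    obtain ⟨c, m, hc⟩ := hg.dyadic (x := cone u 0) ⟨a, M, by simpa using ha⟩
    -- The image of `u ++ w` has length `2 ^ (k - M - w.length)`. For `w` this long the length is `2
    -- ^ (-(m + r))` with `r ≥ 0`, so the image of the left end of `u`, a multiple of `2 ^ (-m)`,
    -- lies on the grid of that mesh, and so does the image interval.
    refine ⟨m + (k - M).toNat, fun w hw => ?_⟩
    obtain ⟨e, he⟩ := exists_cone_zero_eq w
    obtain ⟨r, hr⟩ : ∃ r : ℕ, (w.length : ℤ) = (k - M) + (m + r : ℕ) :=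
      ⟨((w.length : ℤ) - (k - M) - m).toNat, by omega⟩
    have hval : ∀ t : I, (act g (cone (u ++ w) t) : ℝ)
        = ((c * 2 ^ r + e : ℤ) + (t : ℝ)) / 2 ^ (m + r) := by
      intro t
      have hmem : cone u (cone w t) ∈ Set.Icc (cone u 0) (cone u 1) := by
        constructor
        · rw [← Subtype.coe_le_coe, hcu (cone w t)]
          have := (cone w t).2.1
          have : 0 ≤ (cone w t : ℝ) / 2 ^ M := by positivity
          linarith
        · rw [← Subtype.coe_le_coe, hcu (cone w t), hcu 1]
          have := (cone w t).2.2
          have : (cone w t : ℝ) / 2 ^ M ≤ 1 / 2 ^ M := by gcongr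
          simpa using this
      have h5 := hk _ hmem
      have h6 : (2 : ℝ) ^ w.length = 2 ^ k * (2 ^ M)⁻¹ * 2 ^ (m + r) := by
        rw [← zpow_natCast, hr, zpow_add₀ two_ne_zero, zpow_sub₀ two_ne_zero, zpow_natCast,
          zpow_natCast]
        rfl
      have h7 : (2 : ℝ) ^ k ≠ 0 := zpow_ne_zero _ two_ne_zero
      rw [cone_append]
      change (g.1.unop _ : ℝ) = _
      rw [h5, hcu (cone w t), coe_cone w t, he, hc, h6, pow_add]
      push_cast
      field_simp
      ring
    set A : ℤ := c * 2 ^ r + e with hA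
    have h8 : (0 : ℝ) < 2 ^ (m + r) := by positivity
    have hA0 : 0 ≤ A := by
      have := (act g (cone (u ++ w) 0)).2.1
      rw [hval 0, le_div_iff₀ h8] at this
      simp only [zero_mul, Set.Icc.coe_zero, add_zero] at this
      exact_mod_cast this
    have hA1 : A < 2 ^ (m + r) := by
      have := (act g (cone (u ++ w) 1)).2.2
      rw [hval 1, div_le_iff₀ h8] at this
      simp only [one_mul, Set.Icc.coe_one] at this
      have : A + 1 ≤ 2 ^ (m + r) := by exact_mod_cast this
      omega
    obtain ⟨n, hn⟩ := Int.eq_ofNat_of_zero_le hA0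
    obtain ⟨v, hv, hv0⟩ := exists_cone_of_lt (a := n) (m := m + r) (by
      rw [hn] at hA1; exact_mod_cast hA1)
    refine ⟨v, fun t => Subtype.ext ?_⟩
    rw [hval t, coe_cone v t, hv, hv0, hn, add_div]
    simp
  -- The bound is carried from depth `M` up to the root, taking the larger of the bounds of the two
  -- halves.
  have all : ∀ d : ℕ, ∀ u : List Bool, u.length + d = M → ∃ N, ∀ w : List Bool, N ≤ w.length →
      ∃ v, MapsCone g (u ++ w) v := by
    intro d
    induction d with
    | zero => exact fun u hu => base u (by simpa using hu)
    | succ d ih =>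
      intro u hu
      obtain ⟨N0, h0⟩ := ih (u ++ [false]) (by simp; omega)
      obtain ⟨N1, h1⟩ := ih (u ++ [true]) (by simp; omega)
      refine ⟨max N0 N1 + 1, fun w hw => ?_⟩
      obtain _ | ⟨b, w⟩ := w
      · simp at hw
      · rw [List.length_cons] at hw
        cases b
        · obtain ⟨v, hv⟩ := h0 w (by omega)
          exact ⟨v, by simpa using hv⟩
        · obtain ⟨v, hv⟩ := h1 w (by omega)
          exact ⟨v, by simpa using hv⟩
  obtain ⟨N, hN⟩ := all M [] (by simp)
  exact ⟨N, fun w hw => hN w hw.ge⟩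

/-! ### The elements `x i` generate `F` -/

theorem MapsCone.x_succ {n : ℕ} {u v : List Bool} (h : MapsCone (x n) u v) :
    MapsCone (x (n + 1)) (true :: u) (true :: v) := fun t => by
  rw [cone, x_succ_true, h]; rfl

/-- The address `1ⁿ`. -/
abbrev ones (n : ℕ) : List Bool := List.replicate n true

theorem ones_append_of_lt {i j : ℕ} (h : j < i) (w : List Bool) :
    ones i ++ w = ones j ++ true :: (ones (i - j - 1) ++ w) := by
  obtain ⟨k, rfl⟩ := Nat.exists_eq_add_of_lt h
  rw [show j + k + 1 - j - 1 = k by omega, ← List.cons_append, ← List.append_assoc,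
    ← List.replicate_succ, ones, List.replicate_append_replicate, add_assoc]

theorem mapsCone_x_ff (j : ℕ) (w : List Bool) :
    MapsCone (x j) (ones j ++ false :: false :: w) (ones j ++ false :: w) := by
  induction j with
  | zero => exact fun t => x_zero_ff (cone w t)
  | succ j ih => exact ih.x_succ

theorem mapsCone_x_ft (j : ℕ) (w : List Bool) :
    MapsCone (x j) (ones j ++ false :: true :: w) (ones j ++ true :: false :: w) := by
  induction j with
  | zero => exact fun t => x_zero_ft (cone w t)
  | succ j ih => exact ih.x_succ

theorem mapsCone_x_t (j : ℕ) (w : List Bool) :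
    MapsCone (x j) (ones j ++ true :: w) (ones j ++ true :: true :: w) := by
  induction j with
  | zero => exact fun t => x_zero_t (cone w t)
  | succ j ih => exact ih.x_succ

theorem mapsCone_x_of_lt {j k : ℕ} (h : k < j) (w : List Bool) :
    MapsCone (x j) (ones k ++ false :: w) (ones k ++ false :: w) := by
  induction k generalizing j with
  | zero =>
    obtain ⟨n, rfl⟩ := Nat.exists_eq_succ_of_ne_zero h.ne'
    exact fun t => x_succ_false n (cone w t)
  | succ k ih =>
    obtain ⟨n, rfl⟩ := Nat.exists_eq_succ_of_ne_zero (by omega : j ≠ 0)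
    exact (ih (j := n) (by omega)).x_succ

/-- `g` maps the intervals `1ʲ0, 1ʲ⁺¹0, …, 1ᵐ⁻¹0, 1ᵐ` affinely onto the intervals of the list `c`
(of length `m + 1 - j`). -/
def MapsVine (g : F) : ℕ → List (List Bool) → Prop
  | _, [] => False
  | j, [u] => MapsCone g (ones j) u
  | j, u :: v :: c => MapsCone g (ones j ++ [false]) u ∧ MapsVine g (j + 1) (v :: c)

theorem MapsVine.cons {g : F} {j : ℕ} {u : List Bool} {c : List (List Bool)}
    (h : MapsCone g (ones j ++ [false]) u) (hc : MapsVine g (j + 1) c) :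
    MapsVine g j (u :: c) := by
  cases c with
  | nil => exact hc.elim
  | cons v c => exact ⟨h, hc⟩

theorem MapsVine.change {g h : F} {j : ℕ} {c : List (List Bool)} (hc : MapsVine g j c)
    (H : ∀ i w v, j ≤ i → v ∈ c → MapsCone g (ones i ++ w) v →
      ∃ v', MapsCone h (ones i ++ w) v') :
    ∃ c', c'.length = c.length ∧ MapsVine h j c' := by
  induction c generalizing j with
  | nil => exact hc.elim
  | cons u c ih =>
    cases c with
    | nil =>
      obtain ⟨v', hv'⟩ := H j [] u le_rfl (by simp)
        (by rw [List.append_nil]; exact hc)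
      rw [List.append_nil] at hv'
      exact ⟨[v'], rfl, hv'⟩
    | cons v c =>
      obtain ⟨u', hu'⟩ := H j [false] u le_rfl (by simp) hc.1
      obtain ⟨c', hl, hc'⟩ := ih hc.2 fun i w v hi hv =>
        H i w v (by omega) (List.mem_cons_of_mem _ hv)
      exact ⟨u' :: c', by simp [hl], hc'.cons hu'⟩

theorem MapsVine.inv_x_mul {g : F} {i j : ℕ} {c : List (List Bool)} (hij : i ≤ j)
    (h : MapsVine g (j + 1) c) : MapsVine ((x i)⁻¹ * g) (j + 2) c := by
  have key : ∀ j w v, i ≤ j → MapsCone g (ones (j + 1) ++ w) v →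
      MapsCone ((x i)⁻¹ * g) (ones (j + 2) ++ w) v := by
    intro j w v hij hg
    refine MapsCone.mul ?_ hg
    rw [ones_append_of_lt (show i < j + 2 by omega), ones_append_of_lt (show i < j + 1 by omega),
      show j + 2 - i - 1 = (j + 1 - i - 1) + 1 by omega]
    exact (mapsCone_x_t i _).inv
  induction c generalizing j with
  | nil => exact h.elim
  | cons u c ih =>
    cases c with
    | nil => simpa [MapsVine] using key j [] u hij (by simpa [MapsVine] using h)
    | cons v c =>
      exact ⟨key _ _ _ hij h.1, ih (by omega) h.2⟩

/-- The subgroup generated by all the elements `x i`. -/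
noncomputable def xs : Subgroup F := Subgroup.closure (Set.range x)

theorem x_mem_xs (i : ℕ) : x i ∈ xs := Subgroup.subset_closure ⟨i, rfl⟩

/-- Halving a target interval other than the last requires halving the corresponding leaf of the
vine; the inverse generator reshapes the vine accordingly. The last leaf needs no correction, since
halving it only lengthens the vine. -/
theorem MapsVine.split {g : F} {u : List Bool} {c c' : List (List Bool)} {j : ℕ}
    (h : MapsVine g j (c ++ u :: c')) :
    ∃ p : F, (p = 1 ∨ p = (x (j + c.length))⁻¹) ∧
      MapsVine (p * g) j (c ++ (u ++ [false]) :: (u ++ [true]) :: c') := by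
  induction c generalizing j with
  | nil =>
    cases c' with
    | nil =>
      refine ⟨1, Or.inl rfl, ?_⟩
      have h' : MapsCone g (ones j) u := h
      rw [one_mul]
      refine MapsVine.cons (h'.append _) ?_
      have := h'.append [true]
      rwa [ones, ← List.replicate_succ'] at this
    | cons v c' =>
      refine ⟨(x j)⁻¹, Or.inr rfl, MapsVine.cons ?_ (MapsVine.cons ?_ (h.2.inv_x_mul le_rfl))⟩
      · refine (mapsCone_x_ff j []).inv.mul ?_
        simpa using h.1.append [false]
      · have h1 := h.1.append [true]
        have h2 := (mapsCone_x_ft j []).inv.mul (g := (x j)⁻¹) (h := g)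
          (w := u ++ [true]) (by simpa using h1)
        rwa [ones_append_of_lt (Nat.lt_succ_self j), show j.succ - j - 1 = 0 by omega]
  | cons v c ih =>
    obtain ⟨p, hp, h'⟩ := ih (j := j + 1) (by
      cases c with
      | nil => exact h.2
      | cons _ _ => exact h.2)
    have hv : MapsCone g (ones j ++ [false]) v := by
      cases c with
      | nil => exact h.1
      | cons _ _ => exact h.1
    refine ⟨p, hp.imp_right fun hp => ?_, h'.cons (MapsCone.mul ?_ hv)⟩
    · rw [hp, List.length_cons, add_assoc, add_comm 1]
    · rcases hp with rfl | rfl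
      · exact MapsCone.one _
      · exact (mapsCone_x_of_lt (by omega) []).inv

/-- The addresses `u0, u1` of the halves of the intervals in a list. -/
def halves (c : List (List Bool)) : List (List Bool) :=
  c.flatMap fun u => [u ++ [false], u ++ [true]]

/-- Here `c` is the part of the list already processed, which lets the induction run along `c'`. -/
theorem exists_mapsVine_halves (c c' : List (List Bool)) (h : ∃ p ∈ xs, MapsVine p 0 (c ++ c')) :
    ∃ p ∈ xs, MapsVine p 0 (c ++ halves c') := by
  induction c' generalizing c with
  | nil => exact h
  | cons u c' ih =>
    obtain ⟨p, hp, hc⟩ := h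
    obtain ⟨q, hq, hc'⟩ := hc.split
    have := ih (c ++ [u ++ [false], u ++ [true]]) ⟨q * p, xs.mul_mem ?_ hp, by simpa using hc'⟩
    · simpa [halves] using this
    · rcases hq with rfl | rfl
      · exact xs.one_mem
      · exact xs.inv_mem (x_mem_xs _)

theorem exists_mapsVine_length (N : ℕ) :
    ∃ p ∈ xs, ∃ c : List (List Bool), (∀ u ∈ c, u.length = N) ∧ MapsVine p 0 c := by
  induction N with
  | zero => exact ⟨1, xs.one_mem, [[]], by simp, MapsCone.one []⟩
  | succ N ih =>
    obtain ⟨p, hp, c, hl, hc⟩ := ih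
    obtain ⟨q, hq, hc'⟩ := exists_mapsVine_halves [] c ⟨p, hp, hc⟩
    refine ⟨q, hq, halves c, ?_, hc'⟩
    intro u hu
    obtain ⟨v, hv, hu⟩ := List.mem_flatMap.1 hu
    rcases List.mem_pair.1 hu with rfl | rfl <;> simp [hl v hv]

/-- `g` is the identity on the intervals `0, 10, …, 1ʲ⁻¹0`. -/
def FixesVine (g : F) (j : ℕ) : Prop :=
  ∀ k < j, MapsCone g (ones k ++ [false]) (ones k ++ [false])

theorem exists_cone_ones (j : ℕ) (t : I) :
    (∃ k < j, ∃ s, t = cone (ones k ++ [false]) s) ∨ ∃ s, t = cone (ones j) s := by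
  induction j with
  | zero => exact Or.inr ⟨t, rfl⟩
  | succ j ih =>
    rcases ih with ⟨k, hk, s, hs⟩ | ⟨s, rfl⟩
    · exact Or.inl ⟨k, by omega, s, hs⟩
    · obtain ⟨b, s, rfl⟩ := exists_half s
      cases b
      · exact Or.inl ⟨j, by omega, s, by rw [cone_append]; rfl⟩
      · exact Or.inr ⟨s, by rw [ones, ones, List.replicate_succ', cone_append]; rfl⟩

theorem FixesVine.exists_act_cone_ones {g : F} {j : ℕ} (h : FixesVine g j) (s : I) :
    ∃ s', act g (cone (ones j) s) = cone (ones j) s' := by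
  rcases exists_cone_ones j (act g (cone (ones j) s)) with ⟨k, hk, s', hs'⟩ | hs
  · have := act_injective g (hs'.trans (h k hk s').symm)
    exact ⟨s, by rw [hs', ← this]⟩
  · exact hs

theorem eq_ones_append {j : ℕ} {u : List Bool} (h : ∀ t, ∃ s, cone u t = cone (ones j) s) :
    ∃ v, u = ones j ++ v := by
  induction j generalizing u with
  | zero => exact ⟨u, rfl⟩
  | succ j ih =>
    cases u with
    | nil =>
      obtain ⟨s, hs⟩ := h 0
      have := congrArg Subtype.val hs
      rw [ones, List.replicate_succ, cone, cone, coe_half_true] at this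
      have := (cone (ones j) s).2.1
      simp at *
      linarith
    | cons b u =>
      cases b
      · exact absurd (fun t => let ⟨s, hs⟩ := h t; ⟨_, hs⟩) (half_cone_ne false u)
      · obtain ⟨v, rfl⟩ := ih fun t => let ⟨s, hs⟩ := h t; ⟨s, half_injective true hs⟩
        exact ⟨v, rfl⟩

theorem FixesVine.eq_ones_append {g : F} {j : ℕ} (h : FixesVine g j) {w v : List Bool}
    (hg : MapsCone g (ones j ++ w) v) : ∃ v', v = ones j ++ v' := by
  refine Thompson.eq_ones_append fun t => ?_
  rw [← hg, cone_append]
  exact h.exists_act_cone_ones _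

theorem act_zero (g : F) : act g 0 = 0 := g.1.unop.map_bot

theorem act_top (g : F) : act g 1 = 1 := g.1.unop.map_top

theorem cone_ones_one (j : ℕ) : cone (ones j) 1 = 1 := by
  induction j with
  | zero => rfl
  | succ j ih =>
    rw [ones, List.replicate_succ, cone, ih]
    exact Subtype.ext (by rw [coe_half_true]; norm_num)

theorem FixesVine.act_cone_ones_zero {g : F} {j : ℕ} (h : FixesVine g j) :
    act g (cone (ones j) 0) = cone (ones j) 0 := by
  cases j with
  | zero => exact act_zero g
  | succ j =>
    have : cone (ones (j + 1)) 0 = cone (ones j ++ [false]) 1 := by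
      rw [ones, List.replicate_succ', cone_append, cone_append]
      congr 1
      exact Subtype.ext (by rw [cone, cone, cone, cone, coe_half_true, coe_half_false]; simp)
    rw [this, h j (by omega)]

/-- Leaf by leaf, right multiplication by generators makes `g` fix one more leaf of the vine. As `g`
fixes the left end of 1ʲ, the leaf 1ʲ0 goes to some 1ʲ0ᵃ with `a ≥ 1`, and `x j` shortens 1ʲ00 to
1ʲ0. When only 1ʲ is left, `g` fixes both its ends and is the identity. -/
theorem FixesVine.mem_xs_of_mapsVine {g : F} {n : ℕ} {j : ℕ} {c : List (List Bool)}
    (hn : c.length = n) (h : FixesVine g j) (hc : MapsVine g j c) : g ∈ xs := by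
  induction n generalizing g j c with
  | zero => rw [List.length_eq_zero_iff.1 hn] at hc; exact hc.elim
  | succ n ih =>
    obtain _ | ⟨u, _ | ⟨v, c⟩⟩ := c
    · simp at hn
    · have hu : MapsCone g (ones j) u := hc
      obtain ⟨v, rfl⟩ := h.eq_ones_append (w := []) (by simpa using hu)
      have h0 := hu 0
      rw [h.act_cone_ones_zero, cone_append] at h0
      have h0 := cone_injective_right _ h0
      have h1 := hu 1
      rw [(by rw [cone_ones_one, act_top] : act g (cone (ones j) 1) = cone (ones j) 1),
        cone_append] at h1
      have h1 := cone_injective_right _ h1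
      -- The interval `v` has the endpoints 0 and 1, hence length 1.
      have hv : v = [] := by
        have := coe_cone v 1
        rw [← h1, ← h0] at this
        cases v with
        | nil => rfl
        | cons b v =>
          have h2 : (1 : ℝ) < 2 ^ (b :: v).length := one_lt_pow₀ (by norm_num) (by simp)
          have h3 : (2 : ℝ) ^ (b :: v).length ≠ 0 := by positivity
          simp only [Set.Icc.coe_one, Set.Icc.coe_zero, zero_add] at this
          rw [eq_div_iff h3] at this
          linarith
      have : g = 1 := by
        refine ext_act fun t => ?_
        rcases exists_cone_ones j t with ⟨k, hk, s, rfl⟩ | ⟨s, rfl⟩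
        · exact h k hk s
        · rw [hu s, hv, List.append_nil]; rfl
      rw [this]
      exact xs.one_mem
    · obtain ⟨hu, hc⟩ := hc
      obtain ⟨u, rfl⟩ := h.eq_ones_append hu
      have h0 := hu 0
      rw [show cone (ones j ++ [false]) 0 = cone (ones j) 0 by
        rw [cone_append]; congr 1; exact Subtype.ext (by simp [cone, coe_half_false]),
        h.act_cone_ones_zero, cone_append] at h0
      have hu0 := cone_zero_eq_zero (cone_injective_right _ h0).symm
      rw [List.length_cons] at hn
      generalize u.length = a at hu0
      subst hu0
      cases a with
      | zero =>
        exfalso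
        have h1 := hu 1
        rw [List.replicate_zero, List.append_nil,
          (by rw [cone_ones_one, act_top] : cone (ones j) 1 = act g (cone (ones j) 1))] at h1
        have h2 := act_injective g h1
        rw [cone_append] at h2
        have h3 := congrArg Subtype.val (cone_injective_right _ h2)
        rw [cone, coe_half_false] at h3
        simp [cone] at h3
      | succ a =>
      generalize v :: c = c at hn hc
      clear h0
      -- Inner induction on the number `a + 1` of zeros in the image of 1ʲ0: with a single zero the
      -- leaf is fixed and `j` advances, otherwise `g * x j` has one zero fewer.
      induction a generalizing g c with
      | zero =>
        refine ih (j := j + 1) (c := c) (by omega) (fun k hk => ?_) hc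
        rcases Nat.lt_succ_iff_lt_or_eq.1 hk with hk | rfl
        · exact h k hk
        · exact hu
      | succ a iha =>
        obtain ⟨c', hl, hc'⟩ := hc.change (h := g * x j) (by
          intro i w v hi _ hv
          obtain ⟨v, rfl⟩ := h.eq_ones_append
            (by rw [ones_append_of_lt (show j < i by omega)] at hv; exact hv)
          -- `x j` carries every interval inside 1ʲ to a standard one except 1ʲ and 1ʲ0. Neither can
          -- be the image of a later leaf, since both contain the image 1ʲ0ᵃ⁺² of 1ʲ0.
          have no : ∀ z, MapsCone g (ones i ++ w ++ z)
              (ones j ++ List.replicate (a + 1 + 1) false) → False := by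
            intro z hz
            have := hz.left_unique hu
            rw [List.append_assoc, ones_append_of_lt (show j < i by omega)] at this
            simp at this
          match v, hv with
          | [], hv => exact (no _ (by simpa using hv.append (List.replicate (a + 1 + 1) false))).elim
          | [false], hv =>
            exact (no (List.replicate (a + 1) false) (by
              simpa [List.replicate_succ] using hv.append (List.replicate (a + 1) false))).elim
          | false :: false :: v, hv => exact ⟨_, hv.mul (mapsCone_x_ff j v)⟩
          | false :: true :: v, hv => exact ⟨_, hv.mul (mapsCone_x_ft j v)⟩
          | true :: v, hv => exact ⟨_, hv.mul (mapsCone_x_t j v)⟩)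
        have hmem : g * x j ∈ xs := by
          refine iha (g := g * x j) (fun k hk => (h k hk).mul (mapsCone_x_of_lt hk [])) ?_ c'
            (by omega) hc'
          exact hu.mul (mapsCone_x_ff j (List.replicate a false))
        exact (Subgroup.mul_mem_cancel_right _ (x_mem_xs j)).1 hmem

/-- The elements `x i` generate `F`. -/
theorem xs_eq_top : xs = ⊤ := by
  rw [eq_top_iff]
  rintro g -
  obtain ⟨N, hN⟩ := exists_forall_mapsCone g
  obtain ⟨p, hp, c, hl, hc⟩ := exists_mapsVine_length N
  obtain ⟨c', -, hc'⟩ := hc.change (h := p * g) fun i w v _ hv hpv =>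
    let ⟨v', hv'⟩ := hN v (hl v hv); ⟨v', hpv.mul hv'⟩
  have h0 : FixesVine (p * g) 0 := fun k hk => absurd hk (Nat.not_lt_zero k)
  exact (Subgroup.mul_mem_cancel_left _ hp).1 (h0.mem_xs_of_mapsVine rfl hc')

/-! ### Positive words and existence of normal forms -/

/-- The positive element `x_{i₁} ⋯ x_{iₘ}`. -/
noncomputable def pos (p : List ℕ) : F := (p.map x).prod

theorem pos_nil : pos [] = 1 := rfl

theorem pos_cons (i : ℕ) (p : List ℕ) : pos (i :: p) = x i * pos p := by simp [pos]

theorem pos_append (p q : List ℕ) : pos (p ++ q) = pos p * pos q := by simp [pos]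

/-- The inverse letter travels to the right: it passes a larger letter by raising that letter's
index, passes a smaller one by raising its own, and cancels against an equal one. -/
theorem inv_x_mul_pos (i : ℕ) (p : List ℕ) :
    ∃ p' q', (x i)⁻¹ * pos p = pos p' * (pos q')⁻¹ := by
  induction p generalizing i with
  | nil => exact ⟨[], [i], by simp [pos]⟩
  | cons a p ih =>
    rcases lt_trichotomy i a with h | rfl | h
    · obtain ⟨p', q', hpq⟩ := ih i
      refine ⟨(a + 1) :: p', q', ?_⟩
      rw [pos_cons, pos_cons, mul_assoc, ← hpq, inv_mul_eq_iff_eq_mul, ← mul_assoc (x i),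
        ← x_mul_x h]
      group
    · exact ⟨p, [], by simp [pos]⟩
    · obtain ⟨p', q', hpq⟩ := ih (i + 1)
      refine ⟨a :: p', q', ?_⟩
      rw [pos_cons, pos_cons, mul_assoc, ← hpq, inv_mul_eq_iff_eq_mul, ← mul_assoc (x i),
        x_mul_x h]
      group

/-- Every element of `F` is a quotient of positive elements. -/
theorem exists_eq_pos_mul_inv (g : F) : ∃ p q, g = pos p * (pos q)⁻¹ := by
  have hg : g ∈ Subgroup.closure (Set.range x) := by
    change g ∈ xs
    rw [xs_eq_top]; trivial
  induction hg using Subgroup.closure_induction_left with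
  | one => exact ⟨[], [], by simp [pos]⟩
  | mul_left a ha y hy ih =>
    obtain ⟨i, rfl⟩ := ha
    obtain ⟨p, q, rfl⟩ := ih
    exact ⟨i :: p, q, by rw [pos_cons, mul_assoc]⟩
  | inv_mul_cancel a ha y hy ih =>
    obtain ⟨i, rfl⟩ := ha
    obtain ⟨p, q, rfl⟩ := ih
    obtain ⟨p', q', h⟩ := inv_x_mul_pos i p
    exact ⟨p', q ++ q', by rw [← mul_assoc, h, pos_append]; group⟩

/-- Insertion sort by `x i * x a = x a * x (i + 1)` for `a < i`. The lower bound `m` keeps the word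
sorted after the letter just passed. -/
theorem exists_sorted_cons {m i : ℕ} {p : List ℕ} (hp : p.Pairwise (· ≤ ·)) (hi : m ≤ i)
    (hm : ∀ k ∈ p, m ≤ k) :
    ∃ p' : List ℕ, p'.Pairwise (· ≤ ·) ∧ (∀ k ∈ p', m ≤ k) ∧ pos p' = x i * pos p := by
  induction p generalizing i m with
  | nil => exact ⟨[i], by simp, by simpa using hi, by simp [pos]⟩
  | cons a p ih =>
    obtain ⟨ha, hp'⟩ := List.pairwise_cons.1 hp
    have hma := hm a (by simp)
    by_cases h : i ≤ a
    · refine ⟨i :: a :: p, List.pairwise_cons.2 ⟨?_, hp⟩, ?_, pos_cons _ _⟩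
      · rintro k (_ | ⟨_, hk⟩)
        · exact h
        · exact h.trans (ha k hk)
      · rintro k (_ | ⟨_, hk⟩)
        · exact hi
        · exact hm k hk
    · obtain ⟨p', h1, h2, h3⟩ := ih (m := a) (i := i + 1) hp' (by omega) ha
      refine ⟨a :: p', List.pairwise_cons.2 ⟨h2, h1⟩, ?_, ?_⟩
      · rintro k (_ | ⟨_, hk⟩)
        · exact hma
        · exact hma.trans (h2 k hk)
      · rw [pos_cons, h3, pos_cons, ← mul_assoc, ← mul_assoc,
          x_mul_x (show a < i by omega)]

theorem exists_sorted (p : List ℕ) :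
    ∃ p' : List ℕ, p'.Pairwise (· ≤ ·) ∧ pos p' = pos p := by
  induction p with
  | nil => exact ⟨[], by simp, rfl⟩
  | cons i p ih =>
    obtain ⟨p', h, h'⟩ := ih
    obtain ⟨p'', h1, -, h2⟩ := exists_sorted_cons (m := 0) (i := i) h (by simp) (by simp)
    exact ⟨p'', h1, by rw [h2, h', pos_cons]⟩

theorem x_mul_pos {i : ℕ} {p : List ℕ} (h : ∀ k ∈ p, i + 2 ≤ k) :
    x i * pos p = pos (p.map (· - 1)) * x i := by
  induction p with
  | nil => simp [pos]
  | cons a p ih =>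
    have ha := h a (by simp)
    rw [List.map_cons, pos_cons, pos_cons, mul_assoc, ← ih fun k hk => h k (by simp [hk]),
      ← mul_assoc, ← mul_assoc, x_mul_x (show i < a - 1 by omega), show a - 1 + 1 = a by omega]

/-- A letter `x i` can be moved to the end of a sorted positive word without `x (i + 1)`. -/
theorem exists_pos_eq_mul_x {i : ℕ} {p : List ℕ} (hp : p.Pairwise (· ≤ ·)) (hi : i ∈ p)
    (hi' : i + 1 ∉ p) :
    ∃ p' : List ℕ, p'.Pairwise (· ≤ ·) ∧ (∀ m, (∀ k ∈ p, m ≤ k) → ∀ k ∈ p', m ≤ k) ∧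
      p'.length + 1 = p.length ∧ pos p = pos p' * x i := by
  induction p with
  | nil => simp at hi
  | cons a p ih =>
    obtain ⟨ha, hp'⟩ := List.pairwise_cons.1 hp
    rw [List.mem_cons, not_or] at hi'
    by_cases h : i ∈ p
    · obtain ⟨p', h1, h2, h3, h4⟩ := ih hp' h hi'.2
      refine ⟨a :: p', List.pairwise_cons.2 ⟨h2 a ha, h1⟩, ?_, by simp [h3], ?_⟩
      · rintro m hm k (_ | ⟨_, hk⟩)
        · exact hm _ (by simp)
        · exact h2 m (fun k hk => hm k (by simp [hk])) k hk
      · rw [pos_cons, pos_cons, h4, mul_assoc]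
    · obtain rfl : i = a := by simpa [h] using hi
      have h2 : ∀ k ∈ p, i + 2 ≤ k := by
        intro k hk
        have := ha k hk
        have h3 : k ≠ i := fun h' => h (h' ▸ hk)
        have h4 : k ≠ i + 1 := fun h' => hi'.2 (h' ▸ hk)
        omega
      refine ⟨p.map (· - 1), ?_, ?_, by simp, by rw [pos_cons, x_mul_pos h2]⟩
      · exact List.pairwise_map.2 (hp'.imp fun h => by omega)
      · intro m hm k hk
        obtain ⟨k', hk', rfl⟩ := List.mem_map.1 hk
        have := hm i (by simp)
        have := h2 k' hk'
        omega

theorem Word.eval_append (u v : Word) : Word.eval (u ++ v) = u.eval * v.eval := by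
  simp [Word.eval]

theorem Word.eval_pos (p : List ℕ) : Word.eval (p.map fun i => (i, true)) = pos p := by
  induction p with
  | nil => rfl
  | cons i p ih =>
    rw [pos_cons, ← ih]
    simp [Word.eval]

theorem Word.eval_reverse (q : List ℕ) :
    Word.eval (q.reverse.map fun i => (i, false)) = (pos q)⁻¹ := by
  induction q with
  | nil => simp [Word.eval, pos]
  | cons i q ih =>
    rw [List.reverse_cons, List.map_append, Word.eval_append, ih, pos_cons, mul_inv_rev]
    simp [Word.eval]

/-- Every element of `F` is represented by a normal form. -/
theorem exists_isNormalForm (g : F) : ∃ u : Word, u.IsNormalForm ∧ u.eval = g := by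
  classical
  -- A sorted quotient of least total length is a normal form: a violation of either condition would
  -- allow a cancellation.
  have ex : ∃ n, ∃ p q : List ℕ, p.Pairwise (· ≤ ·) ∧ q.Pairwise (· ≤ ·) ∧
      pos p * (pos q)⁻¹ = g ∧ p.length + q.length = n := by
    obtain ⟨p, q, rfl⟩ := exists_eq_pos_mul_inv g
    obtain ⟨p', hp, hp'⟩ := exists_sorted p
    obtain ⟨q', hq, hq'⟩ := exists_sorted q
    exact ⟨_, p', q', hp, hq, by rw [hp', hq'], rfl⟩
  obtain ⟨p, q, hp, hq, hg, hn⟩ := Nat.find_spec ex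
  have minimal : ∀ p' q' : List ℕ, p'.Pairwise (· ≤ ·) → q'.Pairwise (· ≤ ·) →
      pos p' * (pos q')⁻¹ = g → p.length + q.length ≤ p'.length + q'.length :=
    fun p' q' h1 h2 h3 => hn ▸ Nat.find_min' ex ⟨p', q', h1, h2, h3, rfl⟩
  refine ⟨_, ⟨p, q, rfl, hp, hq, ?_, ?_⟩, by
    rw [Word.eval_append, Word.eval_pos, Word.eval_reverse, hg]⟩
  · intro i h1 h2
    obtain ⟨p', rfl⟩ := List.getLast?_eq_some_iff.1 h1
    obtain ⟨q', rfl⟩ := List.getLast?_eq_some_iff.1 h2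
    have := minimal p' q' (List.pairwise_append.1 hp).1 (List.pairwise_append.1 hq).1 (by
      rw [← hg, pos_append, pos_append]
      group)
    simp at this
    omega
  · intro i h1 h2
    -- Without `x (i + 1)`, a letter `x i` can be moved to the end of both words, where the two
    -- copies cancel.
    by_contra! h
    obtain ⟨p', hp', -, hpl, hpe⟩ := exists_pos_eq_mul_x hp h1 h.1
    obtain ⟨q', hq', -, hql, hqe⟩ := exists_pos_eq_mul_x hq h2 h.2
    have := minimal p' q' hp' hq' (by
      rw [← hg, hpe, hqe]
      group)
    omega

/-! ### Double cosets of Jones' subgroup -/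

/-- The element `x i * x (i + 1)` of Jones' subgroup. -/
noncomputable def y (i : ℕ) : F := x i * x (i + 1)

theorem x_mul_y {i j : ℕ} (h : j < i) : x i * y j = y j * x (i + 2) := by
  rw [y, ← mul_assoc, x_mul_x h, mul_assoc, x_mul_x (by omega), mul_assoc]

theorem y_mem_jones (i : ℕ) : y i ∈ jones := by
  have h0 : y 0 ∈ jones := Subgroup.subset_closure (by simp [y])
  induction i using Nat.strong_induction_on with
  | _ i ih =>
    match i, ih with
    | 0, _ => exact h0
    | 1, _ => exact Subgroup.subset_closure (by simp [y])
    | 2, _ => exact Subgroup.subset_closure (by simp [y])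
    | i + 3, ih =>
      -- Conjugation by `y 0` raises positive indices by 2. It says nothing of this kind about `x
      -- 0`, so `y 2` is not reached from `y 0` and is one of the given generators.
      have : y (i + 3) = (y 0)⁻¹ * y (i + 1) * y 0 := by
        rw [mul_assoc, eq_inv_mul_iff_mul_eq]
        change y 0 * (x (i + 3) * x (i + 4)) = x (i + 1) * x (i + 2) * y 0
        rw [← mul_assoc, ← x_mul_y (i := i + 1) (by omega), mul_assoc,
          ← x_mul_y (i := i + 2) (by omega), mul_assoc]
      rw [this]
      exact jones.mul_mem (jones.mul_mem (jones.inv_mem h0) (ih _ (by omega))) h0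

/-- The parity differences of consecutive leaves of a forest with the parity colouring are encoded
by a list of Booleans; this is the effect of adding a caret at the leaf `j`. -/
def insertGap : List Bool → ℕ → List Bool
  | [], 0 => [false, true]
  | [], j + 1 => false :: insertGap [] j
  | b :: l, 0 => false :: (!b) :: l
  | b :: l, j + 1 => b :: insertGap l j

/-- The indices of a positive word which removes all the parity differences of equal colours
recorded in a list, the first of which is at the leaf `k`. -/
def clear : ℕ → List Bool → List ℕ
  | _, [] => []
  | k, false :: l => clear (k + 1) l
  | k, true :: l => k :: clear (k + 2) l

theorem pos_clear_mul_y {k m : ℕ} (h : k < m) (l : List Bool) :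
    pos (clear m l) * y k = y k * pos (clear (m + 2) l) := by
  induction l generalizing m with
  | nil => simp [clear, pos]
  | cons b l ih =>
    cases b
    · exact ih (by omega)
    · rw [clear, clear, pos_cons, pos_cons, mul_assoc, ih (by omega), ← mul_assoc, x_mul_y h,
        mul_assoc]

/-- An entry `true` marks two neighbouring leaves of equal colour, and lists are padded by `false`.
If the gap after the leaf is marked, the new caret is itself the clearing caret and `f = 1`. If not,
the gap after the new right child becomes marked; clearing it completes `x i * x (i + 1)` at that
leaf, and this `y i` moves to the right end by `pos_clear_mul_y`. Earlier clearing carets only shift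
the index. -/
theorem exists_x_mul_pos_clear (k j : ℕ) (l : List Bool) :
    ∃ f ∈ jones, x (k + j) * pos (clear k (insertGap l j)) = pos (clear k l) * f := by
  induction j generalizing k l with
  | zero =>
    match l with
    | [] => exact ⟨y k, y_mem_jones k, by simp [insertGap, clear, pos, y]⟩
    | false :: l =>
      refine ⟨y k, y_mem_jones k, ?_⟩
      rw [insertGap, Bool.not_false, clear, clear, clear, pos_clear_mul_y (by omega), pos_cons,
        ← mul_assoc]
      rfl
    | true :: l => exact ⟨1, jones.one_mem, by simp [insertGap, clear, pos]⟩
  | succ j ih =>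
    match l with
    | [] =>
      obtain ⟨f, hf, h⟩ := ih (k + 1) []
      refine ⟨f, hf, ?_⟩
      rw [insertGap, show k + (j + 1) = k + 1 + j by omega]
      exact h
    | false :: l =>
      obtain ⟨f, hf, h⟩ := ih (k + 1) l
      refine ⟨f, hf, ?_⟩
      rw [insertGap, clear, clear, show k + (j + 1) = k + 1 + j by omega, h]
    | true :: l =>
      obtain ⟨f, hf, h⟩ := ih (k + 2) l
      refine ⟨f, hf, ?_⟩
      rw [insertGap, clear, clear, pos_cons, pos_cons, ← mul_assoc, x_mul_x (by omega), mul_assoc,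
        show k + (j + 1) + 1 = k + 2 + j by omega, h, mul_assoc]

theorem exists_pos_mul_pos_clear (p : List ℕ) (l : List Bool) :
    ∃ l', ∃ f ∈ jones, pos p * pos (clear 0 l') = pos (clear 0 l) * f := by
  induction p generalizing l with
  | nil => exact ⟨l, 1, jones.one_mem, by simp [pos]⟩
  | cons i p ih =>
    obtain ⟨f, hf, h⟩ := exists_x_mul_pos_clear 0 i l
    rw [zero_add] at h
    obtain ⟨l', f', hf', h'⟩ := ih (insertGap l i)
    exact ⟨l', f * f', jones.mul_mem hf hf', by
      rw [pos_cons, mul_assoc, h', ← mul_assoc, h, mul_assoc]⟩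

/-- Every element of `F` lies in the double coset, modulo Jones' subgroup, of the inverse of a
positive word `x_{k₁} ⋯ x_{kₙ}` with gaps `kᵢ₊₁ ≥ kᵢ + 2`. -/
theorem exists_double_coset (w : F) :
    ∃ l, ∃ f ∈ jones, ∃ f' ∈ jones, pos (clear 0 l) = f * w⁻¹ * f' := by
  obtain ⟨p, q, rfl⟩ := exists_eq_pos_mul_inv w
  obtain ⟨l, f, hf, h⟩ := exists_pos_mul_pos_clear q []
  -- The first application turns `(pos q)⁻¹` into a positive word times an element of Jones'
  -- subgroup; the second applies to that word preceded by `p`. The empty list is the alternating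
  -- colouring, for which nothing has to be cleared.
  obtain ⟨l', f', hf', h'⟩ := exists_pos_mul_pos_clear (p ++ clear 0 l) []
  refine ⟨l', f⁻¹, jones.inv_mem hf, f', hf', ?_⟩
  simp only [clear, pos_nil, one_mul, pos_append] at h h'
  rw [← h', ← h]
  group

/-- Here `x k` is the last letter and `s` the product of the others. Moving `y k` to the left
through `s` lowers its index by one per letter; since the gaps are at least 2, the index always
stays above that of the letter being passed. -/
theorem pos_clear_eq_one_or (k₀ : ℕ) (l : List Bool) :
    pos (clear k₀ l) = 1 ∨
      ∃ s k a, k₀ ≤ a ∧ pos (clear k₀ l) = s * x k ∧ y a * s = s * y k := by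
  induction l generalizing k₀ with
  | nil => exact Or.inl rfl
  | cons b l ih =>
    cases b
    · rcases ih (k₀ + 1) with h | ⟨s, k, a, ha, h⟩
      · exact Or.inl h
      · exact Or.inr ⟨s, k, a, by omega, h⟩
    · right
      rcases ih (k₀ + 2) with h | ⟨s, k, a, ha, h, h'⟩
      · exact ⟨1, k₀, k₀, le_rfl, by rw [clear, pos_cons, h, one_mul, mul_one],
          by rw [one_mul, mul_one]⟩
      · refine ⟨x k₀ * s, k, a - 1, by omega, by rw [clear, pos_cons, h, mul_assoc], ?_⟩
        obtain ⟨a, rfl⟩ : ∃ a', a = a' + 1 := ⟨a - 1, by omega⟩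
        rw [Nat.add_sub_cancel, mul_assoc, ← h', y, y, ← mul_assoc, mul_assoc (x a),
          x_mul_x (by omega), ← mul_assoc, x_mul_x (by omega)]
        simp only [mul_assoc]

/-! ### Proper overgroups of Jones' subgroup contain `G` -/

section Overgroup

variable {H : Subgroup F}

theorem x_zero_mul_x_two_mem_of_mem_one (hH : jones ≤ H) (h : x 1 * x 3 ∈ H) :
    x 0 * x 2 ∈ H := by
  have h01 : x 0 * x 1 ∈ H := hH (y_mem_jones 0)
  have h12 : x 1 * x 2 ∈ H := hH (y_mem_jones 1)
  have h23 : x 2 * x 3 ∈ H := hH (y_mem_jones 2)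
  have h21 : x 2 * x 1 ∈ H := by rwa [x_mul_x (by omega)]
  have h2i3 : (x 2)⁻¹ * x 3 ∈ H := by
    have := H.mul_mem (H.inv_mem h12) h
    rwa [show (x 1 * x 2)⁻¹ * (x 1 * x 3) = (x 2)⁻¹ * x 3 by group] at this
  have h22 : x 2 * x 2 ∈ H := by
    have := H.mul_mem h23 (H.inv_mem h2i3)
    rwa [show x 2 * x 3 * ((x 2)⁻¹ * x 3)⁻¹ = x 2 * x 2 by group] at this
  have h1i2 : (x 1)⁻¹ * x 2 ∈ H := by
    have := H.mul_mem (H.inv_mem h21) h22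
    rwa [show (x 2 * x 1)⁻¹ * (x 2 * x 2) = (x 1)⁻¹ * x 2 by group] at this
  have := H.mul_mem h01 h1i2
  rwa [show x 0 * x 1 * ((x 1)⁻¹ * x 2) = x 0 * x 2 by group] at this

/-- Conjugation by `y 0` lowers `k` by 2 as long as the new index is positive, so 1 and 2 remain as
separate cases. -/
theorem x_zero_mul_x_two_mem (hH : jones ≤ H) {k : ℕ} (h : x k * x (k + 2) ∈ H) :
    x 0 * x 2 ∈ H := by
  induction k using Nat.strong_induction_on with
  | _ k ih =>
    match k, ih, h with
    | 0, _, h => exact h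
    | 1, _, h => exact x_zero_mul_x_two_mem_of_mem_one hH h
    | 2, _, h =>
      have hy := hH (y_mem_jones 0)
      have h34 := H.mul_mem (H.inv_mem (hH (y_mem_jones 2))) h
      rw [y, show (x 2 * x (2 + 1))⁻¹ * (x 2 * x (2 + 2)) = (x 3)⁻¹ * x 4 by group] at h34
      -- Lowering `x 2 * x 4` directly would involve the index 0. Dividing by `y 2` first leaves
      -- only the indices 3 and 4, which can be lowered.
      have h12 : (x 1)⁻¹ * x 2 = y 0 * ((x 3)⁻¹ * x 4) * (y 0)⁻¹ := by
        rw [eq_mul_inv_iff_mul_eq, mul_assoc, x_mul_y (by omega), inv_mul_eq_iff_eq_mul,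
          ← mul_assoc, ← mul_assoc, x_mul_y (by omega)]
        group
      have := H.mul_mem hy (H.mul_mem (H.mul_mem hy h34) (H.inv_mem hy))
      rwa [← h12, y, show x 0 * x (0 + 1) * ((x 1)⁻¹ * x 2) = x 0 * x 2 by group] at this
    | k + 3, ih, h =>
      refine ih (k + 1) (by omega) ?_
      have hy := hH (y_mem_jones 0)
      have : x (k + 1) * x (k + 1 + 2) = y 0 * (x (k + 3) * x (k + 3 + 2)) * (y 0)⁻¹ := by
        rw [eq_mul_inv_iff_mul_eq, mul_assoc, x_mul_y (by omega), ← mul_assoc, x_mul_y (by omega),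
          mul_assoc]
      rw [this]
      exact H.mul_mem (H.mul_mem hy h) (H.inv_mem hy)

/-- A subgroup which properly contains Jones' subgroup contains `G`. -/
theorem G_le (hH : jones ≤ H) {w : F} (hw : w ∈ H) (hw' : w ∉ jones) : G ≤ H := by
  have key : x 0 * x 2 ∈ H := by
    obtain ⟨l, f, hf, f', hf', h⟩ := exists_double_coset w
    have hl : pos (clear 0 l) ∈ H := by
      rw [h]
      exact H.mul_mem (H.mul_mem (hH hf) (H.inv_mem hw)) (hH hf')
    rcases pos_clear_eq_one_or 0 l with h1 | ⟨s, k, a, -, hs, ha⟩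
    · refine absurd ?_ hw'
      rw [h1] at h
      have : w = f' * f := by
        rw [← inv_inj, mul_inv_rev, ← mul_right_inj f, mul_inv_cancel_left, eq_inv_iff_mul_eq_one,
          ← h]
      rw [this]
      exact jones.mul_mem hf' hf
    · rw [hs] at hl
      refine x_zero_mul_x_two_mem hH (k := k) ?_
      -- Conjugating `y a` by `s * x k` gives `(x k)⁻¹ * y k * x k = x (k + 1) * x k`.
      have := H.mul_mem (H.mul_mem (H.inv_mem hl) (hH (y_mem_jones a))) hl
      rwa [mul_assoc, ← mul_assoc (y a), ha, y, show (s * x k)⁻¹ * (s * (x k * x (k + 1)) * x k) =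
        x (k + 1) * x k by group, x_mul_x (by omega)] at this
  rw [G, Subgroup.closure_le]
  rintro _ (rfl | rfl)
  · exact key
  · exact hH (y_mem_jones 1)

end Overgroup

/-! ### `G` and the parity of word length -/

theorem conj_x_zero_sq {i : ℕ} (h : 0 < i) :
    x (i + 2) = (x 0 * x 0)⁻¹ * x i * (x 0 * x 0) := by
  rw [mul_assoc, eq_inv_mul_iff_mul_eq, mul_assoc, ← x_mul_x (by omega), ← mul_assoc,
    ← x_mul_x h, mul_assoc]

theorem x_zero_mul_x_two_mem_G : x 0 * x 2 ∈ G := Subgroup.subset_closure (by simp)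

theorem x_one_mul_x_two_mem_G : x 1 * x 2 ∈ G := Subgroup.subset_closure (by simp)

theorem x_one_mul_x_zero_mem_G : x 1 * x 0 ∈ G := by
  rw [x_mul_x (by omega)]
  exact x_zero_mul_x_two_mem_G

theorem x_one_mul_inv_x_zero_mem_G : x 1 * (x 0)⁻¹ ∈ G := by
  have := G.mul_mem x_one_mul_x_two_mem_G (G.inv_mem x_zero_mul_x_two_mem_G)
  rwa [show x 1 * x 2 * (x 0 * x 2)⁻¹ = x 1 * (x 0)⁻¹ by group] at this

theorem x_zero_mul_x_zero_mem_G : x 0 * x 0 ∈ G := by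
  have := G.mul_mem (G.inv_mem x_one_mul_inv_x_zero_mem_G) x_one_mul_x_zero_mem_G
  rwa [show (x 1 * (x 0)⁻¹)⁻¹ * (x 1 * x 0) = x 0 * x 0 by group] at this

/-- Conjugating `x 1 * x 2` by `x 1 * x 0` gives `x 2 * x 4`, and conjugating `x 0 * x 2` by `x 0 *
x 0` gives `x 0 * x 4`; eliminating `x 4` leaves `x 2 * (x 0)⁻¹`. -/
theorem x_two_mul_x_two_mem_G : x 2 * x 2 ∈ G := by
  have h24 : x 2 * x 4 ∈ G := by
    have := G.mul_mem (G.mul_mem (G.inv_mem x_one_mul_x_zero_mem_G) x_one_mul_x_two_mem_G)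
      x_one_mul_x_zero_mem_G
    have h2 : x 2 * (x 1 * x 0) = x 1 * x 0 * x 4 := by
      rw [← mul_assoc, x_mul_x (by omega), mul_assoc, x_mul_x (by omega), mul_assoc]
    rwa [mul_assoc, mul_assoc (x 1) (x 2), h2,
      show (x 1 * x 0)⁻¹ * (x 1 * (x 1 * x 0 * x 4)) = (x 0)⁻¹ * (x 1 * x 0) * x 4 by group,
      x_mul_x (by omega), inv_mul_cancel_left] at this
  have h04 : x 0 * x 4 ∈ G := by
    have := G.mul_mem (G.mul_mem (G.inv_mem x_zero_mul_x_zero_mem_G) x_zero_mul_x_two_mem_G)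
      x_zero_mul_x_zero_mem_G
    rwa [show x 0 * x 4 = (x 0 * x 0)⁻¹ * (x 0 * x 2) * (x 0 * x 0) by
      rw [conj_x_zero_sq (i := 2) (by omega)]; group]
  have := G.mul_mem (G.mul_mem h24 (G.inv_mem h04)) x_zero_mul_x_two_mem_G
  rwa [show x 2 * x 4 * (x 0 * x 4)⁻¹ * (x 0 * x 2) = x 2 * x 2 by group] at this

theorem x_two_mul_inv_x_zero_mem_G : x 2 * (x 0)⁻¹ ∈ G := by
  have h := G.mul_mem x_two_mul_x_two_mem_G (G.inv_mem x_zero_mul_x_two_mem_G)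
  rwa [show x 2 * x 2 * (x 0 * x 2)⁻¹ = x 2 * (x 0)⁻¹ by group] at h

theorem inv_x_zero_mul_x_one_mem_G : (x 0)⁻¹ * x 1 ∈ G := by
  rw [show (x 0)⁻¹ * x 1 = x 2 * (x 0)⁻¹ by
    rw [inv_mul_eq_iff_eq_mul, ← mul_assoc, ← x_mul_x (by omega)]; group]
  exact x_two_mul_inv_x_zero_mem_G

/-- All generators lie in one left coset and one right coset of `G`, which replaces an appeal to
normality. Conjugation by `x 0 * x 0 ∈ G` raises positive indices by 2, so indices up to 2 suffice.
-/
theorem x_mem_cosets_G (i : ℕ) : x 0 * x i ∈ G ∧ x i * (x 0)⁻¹ ∈ G := by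
  have h00 := x_zero_mul_x_zero_mem_G
  induction i using Nat.strong_induction_on with
  | _ i ih =>
    match i, ih with
    | 0, _ => exact ⟨h00, by simp⟩
    | 1, _ =>
      refine ⟨?_, x_one_mul_inv_x_zero_mem_G⟩
      have := G.mul_mem h00 inv_x_zero_mul_x_one_mem_G
      rwa [show x 0 * x 0 * ((x 0)⁻¹ * x 1) = x 0 * x 1 by group] at this
    | 2, _ => exact ⟨x_zero_mul_x_two_mem_G, x_two_mul_inv_x_zero_mem_G⟩
    | i + 3, ih =>
      obtain ⟨h1, h2⟩ := ih (i + 1) (by omega)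
      rw [conj_x_zero_sq (i := i + 1) (by omega)]
      constructor
      · have := G.mul_mem (G.mul_mem (G.inv_mem h00) h1) h00
        rwa [show (x 0 * x 0)⁻¹ * (x 0 * x (i + 1)) * (x 0 * x 0) =
          x 0 * ((x 0 * x 0)⁻¹ * x (i + 1) * (x 0 * x 0)) by group] at this
      · have := G.mul_mem (G.mul_mem (G.inv_mem h00) h2) h00
        rwa [show (x 0 * x 0)⁻¹ * (x (i + 1) * (x 0)⁻¹) * (x 0 * x 0) =
          (x 0 * x 0)⁻¹ * x (i + 1) * (x 0 * x 0) * (x 0)⁻¹ by group] at this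

theorem jones_le_G : jones ≤ G := by
  have h (i j : ℕ) : x i * x j ∈ G := by
    have := G.mul_mem (x_mem_cosets_G i).2 (x_mem_cosets_G j).1
    rwa [show x i * (x 0)⁻¹ * (x 0 * x j) = x i * x j by group] at this
  rw [jones, Subgroup.closure_le]
  rintro _ (rfl | rfl | rfl) <;> exact h _ _

/-- Words of even length represent elements of `G`, and those of odd length elements of the other
coset. -/
theorem eval_mem_G (u : Word) :
    (Even u.length → u.eval ∈ G) ∧ (¬ Even u.length → x 0 * u.eval ∈ G) := by
  induction u with
  | nil => exact ⟨fun _ => G.one_mem, fun h => absurd (by simp) h⟩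
  | cons l u ih =>
    obtain ⟨i, b⟩ := l
    obtain ⟨g, hg, h1, h2⟩ : ∃ g : F, Word.eval ((i, b) :: u) = g * Word.eval u ∧
        x 0 * g ∈ G ∧ g * (x 0)⁻¹ ∈ G := by
      obtain ⟨h1, h2⟩ := x_mem_cosets_G i
      cases b
      · exact ⟨(x i)⁻¹, by simp [Word.eval], by simpa using G.inv_mem h2,
          by simpa using G.inv_mem h1⟩
      · exact ⟨x i, by simp [Word.eval], h1, h2⟩
    rw [hg, List.length_cons, Nat.even_add_one, not_not]
    constructor
    · intro h
      have := G.mul_mem h2 (ih.2 h)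
      rwa [mul_assoc, inv_mul_cancel_left] at this
    · intro h
      rw [← mul_assoc]
      exact G.mul_mem h1 (ih.1 h)

theorem eq_top_of_mem {H : Subgroup F} (hH : G ≤ H) (h : x 0 ∈ H) : H = ⊤ := by
  rw [eq_top_iff, ← xs_eq_top, xs, Subgroup.closure_le]
  rintro _ ⟨i, rfl⟩
  exact (Subgroup.mul_mem_cancel_left H h).1 (hH (x_mem_cosets_G i).1)

end Thompson

theorem theorem3p9 (w : Thompson.F) (hw : w ∉ Thompson.jones) :
    Thompson.G ≤ Subgroup.closure ((Thompson.jones : Set Thompson.F) ∪ {w}) ∧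
    (∃ u : Thompson.Word, u.IsNormalForm ∧ u.eval = w) ∧
    ∀ u : Thompson.Word, u.IsNormalForm → u.eval = w →
      (Even u.length →
        Subgroup.closure ((Thompson.jones : Set Thompson.F) ∪ {w}) = Thompson.G) ∧
      (¬ Even u.length →
        Subgroup.closure ((Thompson.jones : Set Thompson.F) ∪ {w}) = ⊤) := by
  set H := Subgroup.closure ((Thompson.jones : Set Thompson.F) ∪ {w}) with hH
  have hj : Thompson.jones ≤ H := fun g hg => Subgroup.subset_closure (Or.inl hg)
  have hwH : w ∈ H := Subgroup.subset_closure (Or.inr rfl)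
  have hG : Thompson.G ≤ H := Thompson.G_le hj hwH hw
  refine ⟨hG, Thompson.exists_isNormalForm w, ?_⟩
  rintro u - rfl
  obtain ⟨h1, h2⟩ := Thompson.eval_mem_G u
  refine ⟨fun h => le_antisymm ?_ hG, fun h => ?_⟩
  · rw [hH, Subgroup.closure_le, Set.union_subset_iff, Set.singleton_subset_iff]
    exact ⟨Thompson.jones_le_G, h1 h⟩
  · exact Thompson.eq_top_of_mem hG ((Subgroup.mul_mem_cancel_right H hwH).1 (hG (h2 h)))
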